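/- Let $T$ be a locally finite tree (a connected acyclic graph in which every vertex has finitely many neighbours; $T$ also denotes its set of vertices) with graph distance $d$. Let $\Omega$ be its boundary, i.e. the set of equivalence classes of infinite geodesic rays, two rays being equivalent if they eventually coincide up to a shift. Fix $\omega_*\in\Omega$ and put $\partial T=\Omega\setminus\{\omega_*\}$. For $x,y\in T$ write $y\le x$ if $x$ lies on the geodesic ray from $y$ to $\omega_*$, and for $\omega\in\partial T$ write $\omega\le x$ if $x$ lies on the doubly infinite geodesic with endpoints $\omega$ and $\omega_*$. Set $T_x=\{y\in T: y\le x\}$ and $\partial T_x=\{\omega\in\partial T:\omega\le x\}$. Fix an origin $o\in T$, let $o=x_0,x_1,x_2,\dots$ be the successive vertices of the geodesic ray from $o$ to $\omega_*$, and define the level of $x\in T$ by $\ell(x)=\lim_{j\to\infty}(j-d(x,x_j))\in\mathbb Z$. Equip $\partial T$ with the topology generated by the sets $\partial T_x$, $x\in T$, and let $\nu$ be a Borel measure on $\partial T$ with $0<\nu(\partial T_x)<\infty$ for every $x\in T$. Put $m_\nu(x)=\nu(\partial T_x)$. For $f\in L^p(\partial T,\nu)$, $1\le p\le\infty$, real-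 or complex-valued, the Poisson integral of $f$ is $$\mathcal P f(x)=\int_{\partial T}\frac{\chi_{\partial T_x}(\omega)}{m_\nu(x)}\,f(\omega)\,\mathrm d\nu(\omega)=\frac1{m_\nu(x)}\int_{\partial T_x}f\,\mathrm d\nu ,\qquad x\in T.$$ For a function $u$ on $T$ put $\|u\|_{H^p}=\Big(\sup_{k\in\mathbb Z}\sum_{\ell(x)=k}|u(x)|^p\,m_\nu(x)\Big)^{1/p}$ if $1\le p<\infty$, and $\|u\|_{H^\infty}=\sup_{x\in T}|u(x)|$. Let $\sigma$ be a positive measure on $T$ (with all subsets of $T$ measurable), and put $\|u\|_{L^{1,\infty}(T,\sigma)}=\sup_{t>0}t\,\sigma(\{x\in T:|u(x)|>t\})$. Then the following are equivalent: (i) $\sigma$ is a Carleson measure: there is a constant $C>0$ such that $\sigma(T_x)\le C\,\nu(\partial T_x)$ for every $x\in T$; (ii) for every $p\in(1,\infty]$ there is a constant $C=C_p>0$ such that $\|\mathcal P f\|_{L^p(T,\sigma)}\le C\,\|f\|_{L^p(\partial T,\nu)}$ for every $f\in L^p(\partial T,\nu)$, and there is a constant $C>0$ such that $\|\mathcal P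 f\|_{L^{1,\infty}(T,\sigma)}\le C\,\|f\|_{L^1(\partial T,\nu)}$ for every $f\in L^1(\partial T,\nu)$; (iii) for every $p\in(1,\infty]$ there is a constant $C=C_p>0$ such that $\|\mathcal P f\|_{L^p(T,\sigma)}\le C\,\|\mathcal P f\|_{H^p}$ for every $f\in L^p(\partial T,\nu)$. -/

import Mathlib

open MeasureTheory Filter Topology
open scoped ENNReal NNReal

namespace TreeCarleson

variable {V : Type*}

/-- A ray of a graph: an infinite path, given by its successive (pairwise distinct) vertices.
In a tree these are exactly the infinite geodesics. -/
structure Ray (G : SimpleGraph V) where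
  /-- the `n`-th vertex of the ray -/
  toFun : ℕ → V
  adj : ∀ n, G.Adj (toFun n) (toFun (n + 1))
  inj : Function.Injective toFun

/-- Two rays are equivalent when they agree from some place on, up to a shift. -/
instance raySetoid (G : SimpleGraph V) : Setoid (Ray G) where
  r r s := ∃ m n : ℕ, ∀ k : ℕ, r.toFun (m + k) = s.toFun (n + k)
  iseqv :=
    { refl := fun _ => ⟨0, 0, fun _ => rfl⟩
      symm := fun ⟨m, n, h⟩ => ⟨n, m, fun k => (h k).symm⟩
      trans := by
        rintro r s t ⟨m, n, h⟩ ⟨m', n', h'⟩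
        refine ⟨m + m', n' + n, fun k => ?_⟩
        rw [add_assoc, h (m' + k), show n + (m' + k) = m' + (n + k) by omega, h' (n + k),
          add_assoc] }

/-- The boundary `Ω` of a tree: equivalence classes of rays. -/
def Boundary (G : SimpleGraph V) : Type _ := Quotient (raySetoid G)

/-- The boundary point in which a ray ends. -/
def Ray.endpoint {G : SimpleGraph V} (r : Ray G) : Boundary G := Quotient.mk (raySetoid G) r

/-- A doubly infinite geodesic of a tree. -/
structure Line (G : SimpleGraph V) where
  /-- the `n`-th vertex of the line -/
  toFun : ℤ → V
  adj : ∀ n, G.Adj (toFun n) (toFun (n + 1))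
  inj : Function.Injective toFun

/-- The half of a line with nonnegative indices. -/
def Line.forward {G : SimpleGraph V} (g : Line G) : Ray G where
  toFun n := g.toFun n
  adj n := by simpa using g.adj n
  inj _ _ h := by simpa using g.inj h

/-- The half of a line with nonpositive indices, run backwards. -/
def Line.backward {G : SimpleGraph V} (g : Line G) : Ray G where
  toFun n := g.toFun (-n)
  adj n := by
    have h := (g.adj (-(n : ℤ) - 1)).symm
    simpa [sub_eq_add_neg, add_comm] using h
  inj _ _ h := by simpa using g.inj h

/-- The punctured boundary `∂T = Ω ∖ {ω_*}`, where `root = ω_*`. -/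
def PuncturedBoundary (G : SimpleGraph V) (root : Boundary G) : Type _ :=
  {ω : Boundary G // ω ≠ root}

/-- `[x, ω)`: the vertices of the geodesic that starts at `x` and ends in `ω`. -/
def halfGeodesic {G : SimpleGraph V} (x : V) (ω : Boundary G) : Set V :=
  {y | ∃ r : Ray G, r.toFun 0 = x ∧ r.endpoint = ω ∧ y ∈ Set.range r.toFun}

/-- `(ω, ω')`: the vertices of the doubly infinite geodesic with endpoints `ω` and `ω'`. -/
def fullGeodesic {G : SimpleGraph V} (ω ω' : Boundary G) : Set V :=
  {y | ∃ g : Line G, g.backward.endpoint = ω ∧ g.forward.endpoint = ω' ∧ y ∈ Set.range g.toFun}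

/-- The sector `T_x`: the vertices `y` below `x`, that is, with `x ∈ [y, ω_*)`. -/
def sector {G : SimpleGraph V} (root : Boundary G) (x : V) : Set V :=
  {y | x ∈ halfGeodesic y root}

/-- The boundary at infinity `∂T_x` of a sector: the `ω ∈ ∂T` below `x`, that is, with
`x ∈ (ω, ω_*)`. -/
def sectorBoundary {G : SimpleGraph V} (root : Boundary G) (x : V) :
    Set (PuncturedBoundary G root) :=
  {ω | x ∈ fullGeodesic ω.1 root}

/-- The topology of `∂T`. The sets `∂T_x` are the balls of the Gromov distance of `∂T`. -/
instance {G : SimpleGraph V} {root : Boundary G} : TopologicalSpace (PuncturedBoundary G root) :=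
  TopologicalSpace.generateFrom (Set.range (sectorBoundary root))

instance {G : SimpleGraph V} {root : Boundary G} : MeasurableSpace (PuncturedBoundary G root) :=
  borel _

instance {G : SimpleGraph V} {root : Boundary G} : BorelSpace (PuncturedBoundary G root) := ⟨rfl⟩

/-- The level `ℓ(x) = lim_j (j - d(x, x_j))`, where `x_0, x_1, …` enumerates the geodesic `γ` from
the origin `o = x_0` to `ω_*`. In a tree the sequence is eventually constant. -/
noncomputable def level {G : SimpleGraph V} (γ : Ray G) (x : V) : ℤ :=
  haveI : Nonempty ℤ := ⟨0⟩
  limUnder atTop (fun j : ℕ => (j : ℤ) - (G.dist x (γ.toFun j) : ℤ))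

variable {G : SimpleGraph V} {root : Boundary G}

/-- The flow measure `m_ν(x) = ν(∂T_x)`. -/
noncomputable def flow (ν : Measure (PuncturedBoundary G root)) (x : V) : ℝ≥0∞ :=
  ν (sectorBoundary root x)

/-- The Poisson kernel `P(x, ω) = χ_{∂T_x}(ω) / m_ν(x)`. -/
noncomputable def poissonKernel (ν : Measure (PuncturedBoundary G root)) (x : V)
    (ω : PuncturedBoundary G root) : ℝ :=
  (sectorBoundary root x).indicator (fun _ => (1 : ℝ)) ω / (flow ν x).toReal

/-- The Poisson integral `𝒫 f(x) = ∫ P(x, ω) f(ω) dν(ω)`. -/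
noncomputable def poisson {𝕜 : Type*} [RCLike 𝕜] (ν : Measure (PuncturedBoundary G root))
    (f : PuncturedBoundary G root → 𝕜) (x : V) : 𝕜 :=
  ∫ ω, poissonKernel ν x ω • f ω ∂ν

/-- The `H^p`-norm, `1 ≤ p ≤ ∞`, of a function on the tree:
`(sup_k ∑_{ℓ(x) = k} |u(x)|^p m_ν(x))^{1/p}` if `p < ∞`, and `sup_x |u(x)|` if `p = ∞`. -/
noncomputable def hardyNorm {𝕜 : Type*} [RCLike 𝕜] (γ : Ray G)
    (ν : Measure (PuncturedBoundary G root)) (p : ℝ≥0∞) (u : V → 𝕜) : ℝ≥0∞ :=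
  if p = ∞ then ⨆ x, ‖u x‖ₑ
  else (⨆ k : ℤ, ∑' x : {x : V // level γ x = k}, ‖u x‖ₑ ^ p.toReal * flow ν x) ^ (1 / p.toReal)

/-- The weak quasi-norm `‖u‖_{L^{1,∞}(σ)} = sup_{t > 0} t σ{|u| > t}`. -/
noncomputable def weakL1Norm {𝕜 : Type*} [RCLike 𝕜] [MeasurableSpace V] (σ : Measure V)
    (u : V → 𝕜) : ℝ≥0∞ :=
  ⨆ (t : ℝ≥0) (_ : 0 < t), (t : ℝ≥0∞) * σ {x | (t : ℝ) < ‖u x‖}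

/-- `σ` is a Carleson measure: `σ(T_x) ≤ C ν(∂T_x)` for all vertices `x`. -/
def IsCarleson [MeasurableSpace V] (ν : Measure (PuncturedBoundary G root))
    (σ : Measure V) : Prop :=
  ∃ C : ℝ≥0, 0 < C ∧ ∀ x : V, σ (sector root x) ≤ C * ν (sectorBoundary root x)

end TreeCarleson

/-! The choice of `root` turns the tree into a genealogy: each vertex has one parent, the level
rises by one at each step to the parent, and `T_x` is the set of descendants of `x`. Each boundary
point lies in exactly one `∂T_x` per level, so the sectors of one level partition `∂T`, and any two
sector boundaries are nested or disjoint. Thus `𝒫` takes averages over dyadic-like sets.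

(i) ⇒ (ii): a set of vertices where averages are large is covered by maximal sectors with disjoint
boundaries, which gives the weak type (1,1) bound (`mul_measure_le_of_carleson`). Averages do not
exceed the essential supremum, which settles `p = ∞`; truncation at height `t / 2` and the layer
cake formula give `1 < p < ∞`.

(ii) ⇒ (iii): replace `f` by its averages `g` over the sectors of level `-N`. Then `𝒫 g = 𝒫 f` at
all levels at least `-N`, while the `L^p` norm of `g` is at most the `H^p` norm of `𝒫 f`. Apply (ii)
to `g` and let `N → ∞`; no boundary convergence of `𝒫 f` is needed.

(iii) ⇒ (i): test `p = 2` on the indicator of `∂T_x`, whose Poisson integral is 1 on `T_x`. -/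

namespace TreeCarleson

variable {V : Type*} {G : SimpleGraph V} {root : Boundary G}

/-! ### Rays and their endpoints -/

namespace Ray

/-- The ray obtained by omitting the first `n` vertices. -/
def drop (r : Ray G) (n : ℕ) : Ray G where
  toFun k := r.toFun (n + k)
  adj k := r.adj (n + k)
  inj _ _ h := by simpa using r.inj h

@[simp] theorem drop_toFun (r : Ray G) (n k : ℕ) : (r.drop n).toFun k = r.toFun (n + k) := rfl

theorem endpoint_eq_iff {r s : Ray G} :
    r.endpoint = s.endpoint ↔ ∃ m n : ℕ, ∀ k : ℕ, r.toFun (m + k) = s.toFun (n + k) :=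
  ⟨fun h => Quotient.exact h, fun h => Quotient.sound h⟩

@[simp] theorem drop_endpoint (r : Ray G) (n : ℕ) : (r.drop n).endpoint = r.endpoint :=
  endpoint_eq_iff.2 ⟨0, n, fun k => by simp⟩

/-- The ray obtained by putting a new vertex in front. -/
def cons (r : Ray G) (x : V) (hx : G.Adj x (r.toFun 0)) (hr : x ∉ Set.range r.toFun) : Ray G where
  toFun n := Nat.casesOn n x r.toFun
  adj n := by cases n with
    | zero => exact hx
    | succ n => exact r.adj n
  inj m n h := by
    cases m <;> cases n
    · rfl
    · exact absurd ⟨_, h.symm⟩ hr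
    · exact absurd ⟨_, h⟩ hr
    · exact congrArg _ (r.inj h)

@[simp] theorem cons_endpoint (r : Ray G) (x : V) (hx : G.Adj x (r.toFun 0))
    (hr : x ∉ Set.range r.toFun) : (r.cons x hx hr).endpoint = r.endpoint :=
  endpoint_eq_iff.2 ⟨1, 0, fun k => by rw [add_comm, zero_add]; rfl⟩

/-- The initial segment of a ray is a path. -/
theorem exists_isPath (r : Ray G) (n : ℕ) :
    ∃ w : G.Walk (r.toFun 0) (r.toFun n), w.IsPath ∧ w.length = n ∧
      ∀ i ≤ n, w.getVert i = r.toFun i := by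
  induction n generalizing r with
  | zero => exact ⟨.nil, by simp, rfl, by simp⟩
  | succ n ih =>
    obtain ⟨w, hw, hl, hv⟩ : ∃ w : G.Walk (r.toFun 1) (r.toFun (n + 1)), w.IsPath ∧
        w.length = n ∧ ∀ i ≤ n, w.getVert i = r.toFun (i + 1) := by
      rw [add_comm n 1]
      simpa [add_comm 1] using ih (r.drop 1)
    refine ⟨.cons (r.adj 0) w, ?_, by simp [hl], fun i hi => ?_⟩
    · rw [SimpleGraph.Walk.cons_isPath_iff]
      refine ⟨hw, fun h => ?_⟩
      obtain ⟨i, hi, hi'⟩ := SimpleGraph.Walk.mem_support_iff_exists_getVert.1 h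
      rw [hv i (hl ▸ hi')] at hi
      exact absurd (r.inj hi) (by omega)
    · cases i with
      | zero => rfl
      | succ i => exact hv i (by omega)

theorem dist_eq (hG : G.IsTree) (r : Ray G) (n : ℕ) : G.dist (r.toFun 0) (r.toFun n) = n := by
  obtain ⟨w, hw, hl, -⟩ := r.exists_isPath n
  obtain ⟨p, hp, hp'⟩ := hG.connected.exists_path_of_dist (r.toFun 0) (r.toFun n)
  have := congrArg Subtype.val ((hG.isAcyclic.subsingleton_path _ _).elim ⟨w, hw⟩ ⟨p, hp⟩)
  simp only at this
  rw [← hp', ← this, hl]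

/-- A ray of a tree is determined by its first vertex and its endpoint. -/
theorem eq_of_endpoint_eq (hG : G.IsTree) {r s : Ray G} (h0 : r.toFun 0 = s.toFun 0)
    (h : r.endpoint = s.endpoint) (n : ℕ) : r.toFun n = s.toFun n := by
  obtain ⟨m, m', hm⟩ := endpoint_eq_iff.1 h
  -- Both indices are the distance from the common first vertex to the same vertex.
  obtain rfl : m = m' := by
    have h1 := r.dist_eq hG m
    have h2 := s.dist_eq hG m'
    rw [h0, show r.toFun m = s.toFun m' from hm 0, h2] at h1
    exact h1.symm
  obtain ⟨w, hw, -, hv⟩ := r.exists_isPath (m + n)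
  obtain ⟨w', hw', -, hv'⟩ := s.exists_isPath (m + n)
  rw [← hv n (by omega), ← hv' n (by omega)]
  have := congrArg Subtype.val ((hG.isAcyclic.subsingleton_path _ _).elim ⟨w.copy h0 (hm n), by simpa using hw⟩
    ⟨w', hw'⟩)
  simp only at this
  rw [← this, SimpleGraph.Walk.getVert_copy]

end Ray

/-- Every vertex is the first vertex of a ray with a given endpoint. -/
theorem exists_ray (hG : G.IsTree) (root : Boundary G) (x : V) :
    ∃ r : Ray G, r.toFun 0 = x ∧ r.endpoint = root := by
  obtain ⟨r₀, rfl⟩ := Quotient.exists_rep root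
  obtain ⟨w⟩ := hG.connected.preconnected x (r₀.toFun 0)
  -- Carry a ray back along a walk: a new vertex already on the ray truncates it, any other is
  -- prepended.
  suffices H : ∀ {x y : V} (_ : G.Walk x y) (s : Ray G), s.toFun 0 = y →
      ∃ r : Ray G, r.toFun 0 = x ∧ r.endpoint = s.endpoint from H w r₀ rfl
  clear w
  intro x y w
  induction w with
  | nil => exact fun s hs => ⟨s, hs, rfl⟩
  | @cons x y z hxy w ih =>
    intro s hs
    obtain ⟨r, rfl, hr⟩ := ih s hs
    by_cases hx : x ∈ Set.range r.toFun
    · obtain ⟨n, rfl⟩ := hx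
      exact ⟨r.drop n, rfl, by simpa using hr⟩
    · exact ⟨r.cons x hxy hx, rfl, by simpa using hr⟩

/-! ### The parent map and the level -/

open Classical in
/-- The next vertex on the geodesic from `x` to `root`. -/
noncomputable def parent (root : Boundary G) (x : V) : V :=
  if h : ∃ r : Ray G, r.toFun 0 = x ∧ r.endpoint = root then h.choose.toFun 1 else x

theorem parent_toFun (hG : G.IsTree) {r : Ray G} (hr : r.endpoint = root) (n : ℕ) :
    parent root (r.toFun n) = r.toFun (n + 1) := by
  have h : ∃ s : Ray G, s.toFun 0 = r.toFun n ∧ s.endpoint = root := ⟨r.drop n, rfl, by simpa⟩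
  rw [parent, dif_pos h]
  exact Ray.eq_of_endpoint_eq hG (r := h.choose) (s := r.drop n) h.choose_spec.1
    (by simp [h.choose_spec.2, hr]) 1

theorem toFun_add_eq_iterate_parent (hG : G.IsTree) {r : Ray G} (hr : r.endpoint = root)
    (n k : ℕ) : r.toFun (n + k) = (parent root)^[k] (r.toFun n) := by
  induction k with
  | zero => rfl
  | succ k ih => rw [Function.iterate_succ_apply', ← ih, parent_toFun hG hr, add_assoc]

theorem adj_parent (hG : G.IsTree) (x : V) : G.Adj x (parent root x) := by
  obtain ⟨r, rfl, hr⟩ := exists_ray hG root x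
  rw [parent_toFun hG hr]
  exact r.adj 0

/-- A neighbour `y` on the ray from `x` to `root` has index 1 there; otherwise `y` can be prepended
to that ray, and `x` is its parent. -/
theorem eq_parent_or_of_adj (hG : G.IsTree) {x y : V} (h : G.Adj x y) :
    y = parent root x ∨ x = parent root y := by
  obtain ⟨r, rfl, hr⟩ := exists_ray hG root x
  by_cases hy : y ∈ Set.range r.toFun
  · obtain ⟨n, rfl⟩ := hy
    have := r.dist_eq hG n
    rw [SimpleGraph.dist_eq_one_iff_adj.2 h] at this
    exact .inl (by rw [← this, parent_toFun hG hr])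
  · refine .inr ?_
    exact (parent_toFun (r := r.cons y h.symm hy) hG (by simpa using hr) 0).symm

theorem mem_sector_iff (hG : G.IsTree) {x y : V} :
    y ∈ sector root x ↔ ∃ n : ℕ, (parent root)^[n] y = x := by
  constructor
  · rintro ⟨r, rfl, hr, n, rfl⟩
    exact ⟨n, by rw [← toFun_add_eq_iterate_parent hG hr, zero_add]⟩
  · rintro ⟨n, rfl⟩
    obtain ⟨r, rfl, hr⟩ := exists_ray hG root y
    exact ⟨r, rfl, hr, n, by rw [← toFun_add_eq_iterate_parent hG hr, zero_add]⟩

theorem exists_iterate_parent_eq (hG : G.IsTree) {γ : Ray G} (hγ : γ.endpoint = root) (x : V) :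
    ∃ m n : ℕ, (parent root)^[m] x = γ.toFun n := by
  obtain ⟨r, rfl, hr⟩ := exists_ray hG root x
  obtain ⟨m, n, h⟩ := Ray.endpoint_eq_iff.1 (hr.trans hγ.symm)
  exact ⟨m, n, by rw [← toFun_add_eq_iterate_parent hG hr, zero_add]; exact h 0⟩

/-- Once the ray has merged with `γ`, the sequence in the definition of the level is constant. -/
theorem level_toFun_of_eq (hG : G.IsTree) {γ r : Ray G} {m n : ℕ}
    (h : ∀ k : ℕ, r.toFun (m + k) = γ.toFun (n + k)) : level γ (r.toFun 0) = (n : ℤ) - m := by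
  refine Tendsto.limUnder_eq (tendsto_atTop_of_eventually_const (i₀ := n) fun j hj => ?_)
  obtain ⟨k, rfl⟩ := Nat.exists_eq_add_of_le hj
  rw [← h k, r.dist_eq hG]
  push_cast
  ring

theorem level_parent (hG : G.IsTree) {γ : Ray G} (hγ : γ.endpoint = root) (x : V) :
    level γ (parent root x) = level γ x + 1 := by
  obtain ⟨r, rfl, hr⟩ := exists_ray hG root x
  obtain ⟨m, n, h⟩ := Ray.endpoint_eq_iff.1 (hr.trans hγ.symm)
  rw [level_toFun_of_eq hG h, parent_toFun hG hr]
  have := level_toFun_of_eq (r := r.drop 1) (γ := γ) (m := m) (n := n + 1) hG fun k => by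
    rw [Ray.drop_toFun, show 1 + (m + k) = m + (k + 1) by ring, h]
    congr 1
    ring
  simp only [Ray.drop_toFun] at this
  rw [zero_add]
  push_cast at this
  linarith

theorem level_iterate_parent (hG : G.IsTree) {γ : Ray G} (hγ : γ.endpoint = root) (n : ℕ)
    (x : V) : level γ ((parent root)^[n] x) = level γ x + n := by
  induction n with
  | zero => simp
  | succ n ih =>
    rw [Function.iterate_succ_apply', level_parent hG hγ, ih]
    push_cast
    ring

/-- Every vertex reaches `γ` after finitely many parent steps, and the children of a vertex are
among its finitely many neighbours. -/
theorem countable_of_isTree [G.LocallyFinite] (hG : G.IsTree) (γ : Ray G) : Countable V := by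
  have hfin : ∀ y, {x | parent γ.endpoint x = y}.Countable := fun y => by
    refine Set.Countable.mono (s₂ := G.neighborSet y) ?_ (Set.toFinite _).countable
    rintro x rfl
    exact (adj_parent hG x).symm
  have hiter : ∀ (m : ℕ) y, {x | (parent γ.endpoint)^[m] x = y}.Countable := fun m => by
    induction m with
    | zero => intro y; simp
    | succ m ih =>
      intro y
      refine Set.Countable.mono ?_ ((hfin y).biUnion fun z _ => ih z)
      intro x hx
      simp only [Set.mem_ofPred_eq, Function.iterate_succ_apply'] at hx
      simpa using hx
  have : (Set.univ : Set V).Countable := by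
    refine Set.Countable.mono ?_ (Set.countable_iUnion fun m : ℕ =>
      Set.countable_iUnion fun n : ℕ => hiter m (γ.toFun n))
    intro x _
    obtain ⟨m, n, h⟩ := exists_iterate_parent_eq hG (rfl : γ.endpoint = _) x
    exact Set.mem_iUnion₂.2 ⟨m, n, h⟩
  exact Set.countable_univ_iff.1 this

/-! ### Doubly infinite geodesics -/

namespace Line

theorem toFun_add (hG : G.IsTree) {g : Line G} (hg : g.forward.endpoint = root) (i : ℤ) (n : ℕ) :
    g.toFun (i + n) = (parent root)^[n] (g.toFun i) := by
  let r : Ray G := ⟨fun n => g.toFun (i + n), fun n => by simpa [add_assoc] using g.adj (i + n),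
    fun _ _ h => by simpa using g.inj h⟩
  have hr : r.endpoint = root := by
    rw [← hg, Ray.endpoint_eq_iff]
    refine ⟨(-i).toNat, i.toNat, fun k => ?_⟩
    change g.toFun _ = g.toFun _
    congr 1
    push_cast
    omega
  have := toFun_add_eq_iterate_parent hG hr 0 n
  rw [zero_add] at this
  simpa [r] using this

theorem level_toFun (hG : G.IsTree) {γ : Ray G} (hγ : γ.endpoint = root) {g : Line G}
    (hg : g.forward.endpoint = root) (i j : ℤ) :
    level γ (g.toFun j) = level γ (g.toFun i) + (j - i) := by
  wlog hij : i ≤ j generalizing i j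
  · have := this j i (by omega)
    omega
  obtain ⟨n, rfl⟩ := Int.le.dest hij
  rw [toFun_add hG hg, level_iterate_parent hG hγ]
  ring

/-- Two lines with the same endpoints agree at vertices of the same level. -/
theorem eq_of_level_eq (hG : G.IsTree) {γ : Ray G} (hγ : γ.endpoint = root) {g h : Line G}
    (hg : g.forward.endpoint = root) (hh : h.forward.endpoint = root)
    (hgh : g.backward.endpoint = h.backward.endpoint) {i j : ℤ}
    (hl : level γ (g.toFun i) = level γ (h.toFun j)) : g.toFun i = h.toFun j := by
  obtain ⟨m, n, hmn⟩ := Ray.endpoint_eq_iff.1 hgh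
  -- Far enough back that the common vertex precedes both `i` and `j`; equal levels then mean
  -- equally many parent steps from it.
  set k := (-i).toNat + (-j).toNat
  have hk : g.toFun (-((m + k : ℕ) : ℤ)) = h.toFun (-((n + k : ℕ) : ℤ)) := hmn k
  have h1 := level_toFun hG hγ hg (-((m + k : ℕ) : ℤ)) i
  have h2 := level_toFun hG hγ hh (-((n + k : ℕ) : ℤ)) j
  rw [hk] at h1
  have h3 : i + (m + k : ℕ) = j + (n + k : ℕ) := by push_cast at h1 h2 ⊢; omega
  have h4 := toFun_add hG hg (-((m + k : ℕ) : ℤ)) (i + (m + k : ℕ)).toNat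
  have h5 := toFun_add hG hh (-((n + k : ℕ) : ℤ)) (j + (n + k : ℕ)).toNat
  rw [hk, h3, ← h5] at h4
  convert h4 using 2
  · push_cast; omega
  · push_cast; omega

end Line

/-- A ray that does not end in `root` eventually moves away from `root`. -/
theorem exists_forall_eq_parent (hG : G.IsTree) {s : Ray G} (hs : s.endpoint ≠ root) :
    ∃ N, ∀ k, s.toFun (N + k) = parent root (s.toFun (N + k + 1)) := by
  by_cases h : ∃ N, s.toFun N = parent root (s.toFun (N + 1))
  · obtain ⟨N, hN⟩ := h
    refine ⟨N, fun k => ?_⟩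
    induction k with
    | zero => exact hN
    | succ k ih =>
      -- After a step down, a step up would return to the vertex just left.
      refine (eq_parent_or_of_adj (root := root) hG (s.adj (N + (k + 1)))).resolve_left fun h => ?_
      rw [← add_assoc N k 1, ← ih] at h
      exact absurd (s.inj h) (by omega)
  · push Not at h
    have h1 : ∀ n, s.toFun (n + 1) = parent root (s.toFun n) := fun n =>
      (eq_parent_or_of_adj hG (s.adj n)).resolve_right (h n)
    obtain ⟨r, hr0, hr⟩ := exists_ray hG root (s.toFun 0)
    refine absurd ((Ray.endpoint_eq_iff.2 ⟨0, 0, fun k => ?_⟩).trans hr) hs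
    rw [zero_add]
    induction k with
    | zero => exact hr0.symm
    | succ k ih => rw [h1, ih, parent_toFun hG hr]

theorem exists_line (hG : G.IsTree) (ω : PuncturedBoundary G root) :
    ∃ g : Line G, g.backward.endpoint = ω.1 ∧ g.forward.endpoint = root := by
  obtain ⟨s, hs⟩ := Quotient.exists_rep ω.1
  have hs : s.endpoint = ω.1 := hs
  obtain ⟨γ, hγ⟩ := Quotient.exists_rep root
  have hγ : γ.endpoint = root := hγ
  obtain ⟨N, hN⟩ := exists_forall_eq_parent hG (s := s) (hs ▸ ω.2)
  -- The descending tail of `s` run backwards, followed by the parent orbit of `s.toFun N`. Levels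
  -- rise by one along it, hence injectivity.
  let f : ℤ → V := fun n => (parent root)^[n.toNat] (s.toFun (N + (-n).toNat))
  have hf : ∀ n, f (n + 1) = parent root (f n) := fun n => by
    rcases lt_or_ge n 0 with hn | hn
    · have h1 : (n + 1).toNat = 0 := by omega
      have h2 : n.toNat = 0 := by omega
      have h3 : (-n).toNat = (-(n + 1)).toNat + 1 := by omega
      simp only [f, h1, h2, h3, Function.iterate_zero, id, ← add_assoc]
      exact hN _
    · have h1 : (n + 1).toNat = n.toNat + 1 := by omega
      have h2 : (-n).toNat = 0 := by omega
      have h3 : (-(n + 1)).toNat = 0 := by omega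
      simp only [f, h1, h2, h3, Function.iterate_succ_apply']
  have hl : ∀ (i : ℤ) (n : ℕ), level γ (f (i + n)) = level γ (f i) + n := fun i n => by
    induction n with
    | zero => simp
    | succ n ih => push_cast; rw [← add_assoc, hf, level_parent hG hγ, ih]; ring
  have hinj : Function.Injective f := by
    intro i j hij
    wlog h : i ≤ j generalizing i j
    · exact (this hij.symm (by omega)).symm
    obtain ⟨n, rfl⟩ := Int.le.dest h
    have := hl i n
    rw [← hij] at this
    omega
  refine ⟨⟨f, fun n => hf n ▸ adj_parent hG _, hinj⟩, ?_, ?_⟩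
  · rw [← hs, Ray.endpoint_eq_iff]
    refine ⟨0, N, fun k => ?_⟩
    simp [Line.backward, f]
  · obtain ⟨r, hr0, hr⟩ := exists_ray hG root (s.toFun N)
    refine Eq.trans (Ray.endpoint_eq_iff.2 ⟨0, 0, fun k => ?_⟩) hr
    rw [toFun_add_eq_iterate_parent hG hr, hr0]
    simp [Line.forward, f]

/-! ### Nesting of sector boundaries -/

section SectorBoundary

variable {ω : PuncturedBoundary G root} {x y : V} {γ : Ray G}

theorem mem_sectorBoundary_parent (hG : G.IsTree) (h : ω ∈ sectorBoundary root x) :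
    ω ∈ sectorBoundary root (parent root x) := by
  obtain ⟨g, hg, hg', n, rfl⟩ := h
  refine ⟨g, hg, hg', n + 1, ?_⟩
  exact_mod_cast g.toFun_add hG hg' n 1

theorem eq_of_mem_sectorBoundary (hG : G.IsTree) (hγ : γ.endpoint = root)
    (hx : ω ∈ sectorBoundary root x) (hy : ω ∈ sectorBoundary root y)
    (hl : level γ x = level γ y) : x = y := by
  obtain ⟨g, hg, hg', n, rfl⟩ := hx
  obtain ⟨h, hh, hh', m, rfl⟩ := hy
  exact Line.eq_of_level_eq hG hγ hg' hh' (hg.trans hh.symm) hl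

theorem exists_mem_sectorBoundary (hG : G.IsTree) (hγ : γ.endpoint = root)
    (ω : PuncturedBoundary G root) (k : ℤ) :
    ∃ x, level γ x = k ∧ ω ∈ sectorBoundary root x := by
  obtain ⟨g, hg, hg'⟩ := exists_line hG ω
  refine ⟨g.toFun (k - level γ (g.toFun 0)), ?_, g, hg, hg', _, rfl⟩
  rw [g.level_toFun hG hγ hg' 0]
  ring

theorem sectorBoundary_subset (hG : G.IsTree) (h : y ∈ sector root x) :
    sectorBoundary root y ⊆ sectorBoundary root x := by
  obtain ⟨n, rfl⟩ := (mem_sector_iff hG).1 h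
  intro ω hω
  induction n with
  | zero => exact hω
  | succ n ih =>
    rw [Function.iterate_succ_apply']
    exact mem_sectorBoundary_parent hG (ih ((mem_sector_iff hG).2 ⟨n, rfl⟩))

/-- Of two sectors with a common boundary point, the one of higher level contains the other. -/
theorem mem_sector_of_mem_sectorBoundary (hG : G.IsTree) (hγ : γ.endpoint = root)
    (hx : ω ∈ sectorBoundary root x) (hy : ω ∈ sectorBoundary root y)
    (hl : level γ y ≤ level γ x) : y ∈ sector root x := by
  obtain ⟨n, hn⟩ := Int.le.dest hl
  refine (mem_sector_iff hG).2 ⟨n, ?_⟩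
  refine eq_of_mem_sectorBoundary hG hγ (ω := ω)
    (sectorBoundary_subset hG ((mem_sector_iff hG).2 ⟨n, rfl⟩) hy) hx ?_
  rw [level_iterate_parent hG hγ, hn]

theorem measurableSet_sectorBoundary (x : V) : MeasurableSet (sectorBoundary root x) :=
  (TopologicalSpace.isOpen_generateFrom_of_mem (Set.mem_range_self x)).measurableSet

end SectorBoundary

/-! ### Poisson integrals as averages -/

section Poisson

variable {𝕜 : Type*} [RCLike 𝕜] {ν : Measure (PuncturedBoundary G root)}

theorem poisson_eq_setIntegral (f : PuncturedBoundary G root → 𝕜) (x : V) :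
    poisson ν f x = (flow ν x).toReal⁻¹ • ∫ ω in sectorBoundary root x, f ω ∂ν := by
  rw [poisson, ← integral_smul, ← integral_indicator (measurableSet_sectorBoundary x)]
  congr 1 with ω
  by_cases h : ω ∈ sectorBoundary root x <;> simp [poissonKernel, h]

theorem enorm_poisson_mul_flow_le {x : V} (h0 : flow ν x ≠ 0) (ht : flow ν x ≠ ∞)
    (f : PuncturedBoundary G root → 𝕜) :
    ‖poisson ν f x‖ₑ * flow ν x ≤ ∫⁻ ω in sectorBoundary root x, ‖f ω‖ₑ ∂ν := by
  have h : ‖(flow ν x).toReal⁻¹‖ₑ = (flow ν x)⁻¹ := by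
    rw [← ENNReal.toReal_inv, Real.enorm_eq_ofReal ENNReal.toReal_nonneg,
      ENNReal.ofReal_toReal (by simpa)]
  rw [poisson_eq_setIntegral, enorm_smul, h, mul_comm, ← mul_assoc, ENNReal.mul_inv_cancel h0 ht,
    one_mul]
  exact enorm_integral_le_lintegral_enorm _

theorem enorm_poisson_le_eLpNorm_top {x : V} (h0 : flow ν x ≠ 0) (ht : flow ν x ≠ ∞)
    (f : PuncturedBoundary G root → 𝕜) : ‖poisson ν f x‖ₑ ≤ eLpNorm f ∞ ν := by
  have h : ∫⁻ ω in sectorBoundary root x, ‖f ω‖ₑ ∂ν ≤ eLpNorm f ∞ ν * flow ν x := by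
    rw [flow, ← setLIntegral_const]
    refine lintegral_mono_ae (ae_restrict_of_ae ?_)
    rw [eLpNorm_exponent_top]
    exact enorm_ae_le_eLpNormEssSup f ν
  exact (ENNReal.mul_le_mul_iff_left h0 ht).1 ((enorm_poisson_mul_flow_le h0 ht f).trans h)

end Poisson

/-! ### Weak and strong type estimates from the Carleson condition -/

section Carleson

variable [MeasurableSpace V] {γ : Ray G} {ν : Measure (PuncturedBoundary G root)} {σ : Measure V}
  {C : ℝ≥0∞}

/-- The covering argument behind the weak type estimate, in terms of the maximal sectors. -/
theorem mul_measure_le_of_carleson [Countable V] (hG : G.IsTree) (hγ : γ.endpoint = root)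
    (hC : ∀ x : V, σ (sector root x) ≤ C * ν (sectorBoundary root x))
    (g : PuncturedBoundary G root → ℝ≥0∞) {t : ℝ≥0∞} {E : Set V}
    (hE : ∀ x ∈ E, t * flow ν x ≤ ∫⁻ ω in sectorBoundary root x, g ω ∂ν) :
    t * σ E ≤ C * ∫⁻ ω, g ω ∂ν := by
  -- Levels in `E` may be unbounded above, so maximal sectors need not exist. Truncating at level
  -- `N` provides them, and continuity from below removes the truncation.
  let S : ℕ → Set V := fun N => {x ∈ E | level γ x ≤ N}
  have hS : E = ⋃ N, S N := by
    ext x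
    simp only [S, Set.mem_iUnion, Set.mem_sep_iff, exists_and_left, iff_self_and]
    exact fun _ => ⟨(level γ x).toNat, by omega⟩
  have hmono : Monotone S := fun M N hMN x hx => ⟨hx.1, hx.2.trans (by exact_mod_cast hMN)⟩
  rw [hS, hmono.directed_le.measure_iUnion, ENNReal.mul_iSup]
  refine iSup_le fun N => ?_
  let M : Set V := {y ∈ S N | ∀ z ∈ S N, y ∈ sector root z → level γ z ≤ level γ y}
  have hM : S N ⊆ ⋃ y : M, sector root y.1 := by
    intro x hx
    obtain ⟨l, ⟨z, hz, hxz, rfl⟩, hl⟩ := Int.exists_greatest_of_bdd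
      (P := fun l => ∃ z ∈ S N, x ∈ sector root z ∧ level γ z = l)
      ⟨N, by rintro _ ⟨z, hz, -, rfl⟩; exact hz.2⟩
      ⟨_, x, hx, (mem_sector_iff hG).2 ⟨0, rfl⟩, rfl⟩
    refine Set.mem_iUnion.2 ⟨⟨z, hz, fun w hw hzw => hl _ ⟨w, hw, ?_, rfl⟩⟩, hxz⟩
    obtain ⟨m, rfl⟩ := (mem_sector_iff hG).1 hxz
    obtain ⟨n, rfl⟩ := (mem_sector_iff hG).1 hzw
    exact (mem_sector_iff hG).2 ⟨n + m, Function.iterate_add_apply _ _ _ _⟩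
  have hdisj : Pairwise (Function.onFun Disjoint fun y : M => sectorBoundary root y.1) := by
    intro y z hyz
    refine Set.disjoint_left.2 fun ω hy hz => hyz (Subtype.ext ?_)
    refine eq_of_mem_sectorBoundary hG hγ hy hz ?_
    rcases le_total (level γ y.1) (level γ z.1) with h | h
    · exact le_antisymm h (y.2.2 _ z.2.1 (mem_sector_of_mem_sectorBoundary hG hγ hz hy h))
    · exact le_antisymm (z.2.2 _ y.2.1 (mem_sector_of_mem_sectorBoundary hG hγ hy hz h)) h
  calc t * σ (S N) ≤ t * ∑' y : M, σ (sector root y.1) := by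
        gcongr
        exact (measure_mono hM).trans (measure_iUnion_le _)
    _ ≤ t * ∑' y : M, C * flow ν y.1 := by
        gcongr with y
        exact hC y
    _ = C * ∑' y : M, t * flow ν y.1 := by
        rw [ENNReal.tsum_mul_left, ENNReal.tsum_mul_left]
        ring
    _ ≤ C * ∑' y : M, ∫⁻ ω in sectorBoundary root y.1, g ω ∂ν := by
        gcongr with y
        exact hE _ y.2.1.1
    _ ≤ C * ∫⁻ ω, g ω ∂ν := by
        rw [← lintegral_iUnion (fun y : M => measurableSet_sectorBoundary y.1) hdisj]
        gcongr
        exact Measure.restrict_le_self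

variable {𝕜 : Type*} [RCLike 𝕜]

theorem weakL1Norm_poisson_le [Countable V] (hG : G.IsTree) (hγ : γ.endpoint = root)
    (hν : ∀ x : V, flow ν x ≠ 0 ∧ flow ν x ≠ ∞)
    (hC : ∀ x : V, σ (sector root x) ≤ C * ν (sectorBoundary root x))
    (f : PuncturedBoundary G root → 𝕜) :
    weakL1Norm σ (poisson ν f) ≤ C * eLpNorm f 1 ν := by
  rw [eLpNorm_one_eq_lintegral_enorm]
  refine iSup₂_le fun t _ => mul_measure_le_of_carleson hG hγ hC _ fun x hx => ?_
  refine le_trans ?_ (enorm_poisson_mul_flow_le (hν x).1 (hν x).2 f)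
  gcongr
  have hx : (t : ℝ) < ‖poisson ν f x‖ := hx
  rw [← ofReal_norm, ← ENNReal.ofReal_coe_nnreal]
  exact ENNReal.ofReal_le_ofReal hx.le

/-- The weak type estimate for the truncation of `f` at the height `t / 2`. -/
theorem mul_measure_lt_norm_poisson_le [Countable V] (hG : G.IsTree) (hγ : γ.endpoint = root)
    (hν : ∀ x : V, flow ν x ≠ 0 ∧ flow ν x ≠ ∞)
    (hC : ∀ x : V, σ (sector root x) ≤ C * ν (sectorBoundary root x))
    (f : PuncturedBoundary G root → 𝕜) {t : ℝ} (ht : 0 < t) :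
    ENNReal.ofReal (t / 2) * σ {x | t < ‖poisson ν f x‖} ≤
      C * ν.withDensity (fun ω => ‖f ω‖ₑ) {ω | t < 2 * ‖f ω‖} := by
  set A : Set (PuncturedBoundary G root) := {ω | t < 2 * ‖f ω‖}
  refine (mul_measure_le_of_carleson hG hγ hC (A.indicator fun ω => ‖f ω‖ₑ) fun x hx => ?_).trans ?_
  · have hx : t < ‖poisson ν f x‖ := hx
    -- Off `A` one has `|f| ≤ t / 2`, so this part contributes at most `t / 2` to the average; the
    -- part on `A` must supply the rest.
    have h1 : ENNReal.ofReal t * flow ν x ≤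
        (∫⁻ ω in sectorBoundary root x, A.indicator (fun ω => ‖f ω‖ₑ) ω ∂ν) +
          ENNReal.ofReal (t / 2) * flow ν x := by
      calc ENNReal.ofReal t * flow ν x ≤ ‖poisson ν f x‖ₑ * flow ν x := by
            rw [← ofReal_norm]
            gcongr
        _ ≤ ∫⁻ ω in sectorBoundary root x, ‖f ω‖ₑ ∂ν :=
            enorm_poisson_mul_flow_le (hν x).1 (hν x).2 f
        _ ≤ ∫⁻ ω in sectorBoundary root x,
              (A.indicator (fun ω => ‖f ω‖ₑ) ω + ENNReal.ofReal (t / 2)) ∂ν := by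
            refine lintegral_mono fun ω => ?_
            by_cases hω : ω ∈ A
            · simp [hω]
            · have : 2 * ‖f ω‖ ≤ t := not_lt.1 hω
              simp only [hω, not_false_eq_true, Set.indicator_of_notMem, zero_add]
              rw [← ofReal_norm]
              exact ENNReal.ofReal_le_ofReal (by linarith)
        _ = _ := by rw [lintegral_add_right _ measurable_const, setLIntegral_const, flow]
    have h2 : ENNReal.ofReal t = ENNReal.ofReal (t / 2) + ENNReal.ofReal (t / 2) := by
      rw [← ENNReal.ofReal_add (by positivity) (by positivity), add_halves]
    rw [h2, add_mul] at h1
    exact (ENNReal.add_le_add_iff_right (ENNReal.mul_ne_top ENNReal.ofReal_ne_top (hν x).2)).1 h1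
  · gcongr
    exact (lintegral_indicator_le _ _).trans (withDensity_apply_le _ _)

/-- Marcinkiewicz interpolation by hand: write the left side by the layer cake formula, insert the
truncated weak estimate, and apply the formula again with exponent `p - 1` to `2|f|` and the measure
`|f| ν`. The constant is `2 ^ p * p * C / (p - 1)`. -/
theorem lintegral_enorm_poisson_rpow_le [Countable V] [DiscreteMeasurableSpace V] (hG : G.IsTree)
    (hγ : γ.endpoint = root) (hν : ∀ x : V, flow ν x ≠ 0 ∧ flow ν x ≠ ∞) (hCt : C ≠ ∞)
    (hC : ∀ x : V, σ (sector root x) ≤ C * ν (sectorBoundary root x)) {p : ℝ} (hp : 1 < p)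
    {f : PuncturedBoundary G root → 𝕜} (hf : AEStronglyMeasurable f ν) :
    ∫⁻ x, ‖poisson ν f x‖ₑ ^ p ∂σ ≤
      (ENNReal.ofReal p * (2 * C) / ENNReal.ofReal (p - 1) * ENNReal.ofReal (2 ^ (p - 1))) *
        ∫⁻ ω, ‖f ω‖ₑ ^ p ∂ν := by
  set ν' := ν.withDensity fun ω => ‖f ω‖ₑ
  have hp1 : 0 < p - 1 := by linarith
  have hpow : ∀ (a : 𝕜) {q : ℝ}, 0 < q → ‖a‖ₑ ^ q = ENNReal.ofReal (‖a‖ ^ q) := fun a q hq => by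
    rw [← ofReal_norm, ENNReal.ofReal_rpow_of_nonneg (norm_nonneg a) hq.le]
  have h1 : ∫⁻ x, ‖poisson ν f x‖ₑ ^ p ∂σ = ENNReal.ofReal p * ∫⁻ t in Set.Ioi (0 : ℝ),
      σ {x | t < ‖poisson ν f x‖} * ENNReal.ofReal (t ^ (p - 1)) := by
    rw [← lintegral_rpow_eq_lintegral_meas_lt_mul σ (.of_forall fun x => norm_nonneg _)
      (Measurable.of_discrete.aemeasurable) (by linarith)]
    exact lintegral_congr fun x => hpow _ (by linarith)
  have h2 : ∫⁻ t in Set.Ioi (0 : ℝ), σ {x | t < ‖poisson ν f x‖} * ENNReal.ofReal (t ^ (p - 1)) ≤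
      2 * C * ∫⁻ t in Set.Ioi (0 : ℝ),
        ν' {ω | t < 2 * ‖f ω‖} * ENNReal.ofReal (t ^ (p - 1 - 1)) := by
    rw [← lintegral_const_mul' _ _ (ENNReal.mul_ne_top (by simp) hCt)]
    refine setLIntegral_mono' measurableSet_Ioi fun t ht => ?_
    have ht : 0 < t := ht
    -- Splits off the factor `t / 2` that the weak estimate consumes.
    have h3 : ENNReal.ofReal (t ^ (p - 1)) =
        2 * ENNReal.ofReal (t / 2) * ENNReal.ofReal (t ^ (p - 1 - 1)) := by
      rw [show (2 : ℝ≥0∞) = ENNReal.ofReal 2 by simp, ← ENNReal.ofReal_mul (by norm_num),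
        ← ENNReal.ofReal_mul (by positivity)]
      congr 1
      rw [Real.rpow_sub_one ht.ne' (p - 1)]
      field_simp
    calc _ = 2 * (ENNReal.ofReal (t / 2) * σ {x | t < ‖poisson ν f x‖}) *
          ENNReal.ofReal (t ^ (p - 1 - 1)) := by rw [h3]; ring
      _ ≤ 2 * (C * ν' {ω | t < 2 * ‖f ω‖}) * ENNReal.ofReal (t ^ (p - 1 - 1)) := by
          gcongr ?_ * _
          exact mul_le_mul_right (mul_measure_lt_norm_poisson_le hG hγ hν hC f ht) 2
      _ = _ := by ring
  have hfm : AEMeasurable (fun ω => 2 * ‖f ω‖) ν := hf.norm.aemeasurable.const_mul 2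
  have h4 : ∫⁻ t in Set.Ioi (0 : ℝ), ν' {ω | t < 2 * ‖f ω‖} * ENNReal.ofReal (t ^ (p - 1 - 1)) =
      (∫⁻ ω, ENNReal.ofReal ((2 * ‖f ω‖) ^ (p - 1)) ∂ν') / ENNReal.ofReal (p - 1) := by
    rw [ENNReal.eq_div_iff (by simpa using hp1) ENNReal.ofReal_ne_top]
    exact (lintegral_rpow_eq_lintegral_meas_lt_mul ν' (.of_forall fun ω => by positivity)
      (hfm.mono_ac (withDensity_absolutelyContinuous _ _)) hp1).symm
  have h5 : ∫⁻ ω, ENNReal.ofReal ((2 * ‖f ω‖) ^ (p - 1)) ∂ν' =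
      ENNReal.ofReal (2 ^ (p - 1)) * ∫⁻ ω, ‖f ω‖ₑ ^ p ∂ν := by
    rw [lintegral_withDensity_eq_lintegral_mul₀ hf.enorm
      (hfm.pow_const _).ennreal_ofReal, ← lintegral_const_mul' _ _ ENNReal.ofReal_ne_top]
    refine lintegral_congr fun ω => ?_
    rw [Pi.mul_apply, hpow _ (by linarith), ← ofReal_norm, ← ENNReal.ofReal_mul (norm_nonneg _),
      ← ENNReal.ofReal_mul (by positivity), Real.mul_rpow (by norm_num) (norm_nonneg _)]
    congr 1
    rw [mul_left_comm, ← Real.rpow_one_add' (norm_nonneg _) (by linarith)]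
    ring_nf
  rw [h1]
  refine (mul_le_mul_right h2 _).trans_eq ?_
  rw [h4, h5, div_eq_mul_inv, div_eq_mul_inv]
  ring

end Carleson

/-! ### Projection of the boundary to a level -/

section LevelProj

variable {γ : Ray G} {k : ℤ} {ω : PuncturedBoundary G root} {x : V}

open Classical in
/-- The vertex of level `k` on the geodesic from `ω` to `root`. -/
noncomputable def levelProj (γ : Ray G) (k : ℤ) (ω : PuncturedBoundary G root) : V :=
  if h : ∃ x, level γ x = k ∧ ω ∈ sectorBoundary root x then h.choose else γ.toFun 0

theorem levelProj_spec (hG : G.IsTree) (hγ : γ.endpoint = root) (k : ℤ)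
    (ω : PuncturedBoundary G root) :
    level γ (levelProj γ k ω) = k ∧ ω ∈ sectorBoundary root (levelProj γ k ω) := by
  have h := exists_mem_sectorBoundary hG hγ ω k
  rw [levelProj, dif_pos h]
  exact h.choose_spec

theorem levelProj_eq_iff (hG : G.IsTree) (hγ : γ.endpoint = root) :
    levelProj γ k ω = x ↔ level γ x = k ∧ ω ∈ sectorBoundary root x := by
  constructor
  · rintro rfl
    exact levelProj_spec hG hγ k ω
  · rintro ⟨hl, hω⟩
    have h := levelProj_spec hG hγ k ω
    exact eq_of_mem_sectorBoundary hG hγ h.2 hω (h.1.trans hl.symm)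

theorem sectorBoundary_eq_iUnion (hG : G.IsTree) (hγ : γ.endpoint = root) {k : ℤ} {x : V}
    (hk : k ≤ level γ x) : sectorBoundary root x =
      ⋃ y : {y : V // level γ y = k ∧ y ∈ sector root x}, sectorBoundary root y.1 := by
  ext ω
  simp only [Set.mem_iUnion]
  constructor
  · intro hω
    have h := levelProj_spec hG hγ k ω
    exact ⟨⟨_, h.1, mem_sector_of_mem_sectorBoundary hG hγ hω h.2 (h.1.trans_le hk)⟩, h.2⟩
  · rintro ⟨y, hω⟩
    exact sectorBoundary_subset hG y.2.2 hω

variable [MeasurableSpace V] [Countable V]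

theorem measurable_levelProj (hG : G.IsTree) (hγ : γ.endpoint = root) (k : ℤ) :
    Measurable (levelProj (root := root) γ k) := by
  refine measurable_to_countable' fun x => ?_
  by_cases h : level γ x = k
  · convert! measurableSet_sectorBoundary (root := root) x using 1
    ext ω
    simp [levelProj_eq_iff hG hγ, h]
  · convert! MeasurableSet.empty using 1
    ext ω
    simp [levelProj_eq_iff hG hγ, h]

/-- The image of `ν` under the projection gives mass `m_ν(x)` to each `x` of level `k`. So the level
sums in the `H^p` norm become integrals over `∂T`. -/
theorem lintegral_comp_levelProj [DiscreteMeasurableSpace V] (hG : G.IsTree) (hγ : γ.endpoint = root)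
    (ν : Measure (PuncturedBoundary G root)) (k : ℤ) (h : V → ℝ≥0∞) :
    ∫⁻ ω, h (levelProj γ k ω) ∂ν = ∑' x : {x : V // level γ x = k}, h x * flow ν x := by
  have hm := measurable_levelProj hG hγ k
  rw [← lintegral_map (Measurable.of_discrete (f := h)) hm, lintegral_countable']
  refine (tsum_subtype_eq_of_support_subset (s := {x | level γ x = k}) ?_).symm.trans
    (tsum_congr fun x => ?_)
  · intro x hx
    by_contra hl
    have hl : level γ x ≠ k := hl
    refine hx ?_
    beta_reduce
    rw [Measure.map_apply hm (measurableSet_singleton x)]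
    convert! mul_zero _
    convert! measure_empty (μ := ν)
    ext ω
    simp [levelProj_eq_iff hG hγ, hl]
  · rw [Measure.map_apply hm (measurableSet_singleton _), flow]
    congr 2
    ext ω
    have hx : level γ x.1 = k := x.2
    simp [levelProj_eq_iff hG hγ, hx]

end LevelProj

/-! ### From `L^p` bounds to `H^p` bounds -/

section Hardy

variable {γ : Ray G} {ν : Measure (PuncturedBoundary G root)} {𝕜 : Type*}
  [RCLike 𝕜]

theorem eLpNorm_comp_levelProj_le_hardyNorm [MeasurableSpace V] [DiscreteMeasurableSpace V]
    [Countable V] (hG : G.IsTree) (hγ : γ.endpoint = root) (k : ℤ)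
    {p : ℝ≥0∞} (hp : p ≠ 0) (hpt : p ≠ ∞) (u : V → 𝕜) :
    eLpNorm (fun ω => u (levelProj γ k ω)) p ν ≤ hardyNorm γ ν p u := by
  rw [eLpNorm_eq_lintegral_rpow_enorm_toReal hp hpt, hardyNorm, if_neg hpt,
    lintegral_comp_levelProj hG hγ ν k fun x => ‖u x‖ₑ ^ p.toReal]
  gcongr
  exact le_iSup (fun k : ℤ => ∑' x : {x : V // level γ x = k}, ‖u x‖ₑ ^ p.toReal * flow ν x) k

theorem integrableOn_sectorBoundary {p : ℝ≥0∞} (hp : 1 ≤ p) {x : V} (ht : flow ν x ≠ ∞)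
    {f : PuncturedBoundary G root → 𝕜} (hf : MemLp f p ν) :
    IntegrableOn f (sectorBoundary root x) ν := by
  have : IsFiniteMeasure (ν.restrict (sectorBoundary root x)) :=
    ⟨by simpa [flow] using lt_top_iff_ne_top.2 ht⟩
  exact (hf.restrict _).integrable hp

/-- Averaging `f` over the sectors of level `k` does not change its Poisson integral at the
vertices of level at least `k`. -/
theorem poisson_comp_levelProj [Countable V] (hG : G.IsTree) (hγ : γ.endpoint = root)
    (hν : ∀ x : V, flow ν x ≠ 0 ∧ flow ν x ≠ ∞) {k : ℤ} {x : V} (hk : k ≤ level γ x)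
    {f : PuncturedBoundary G root → 𝕜} (hf : IntegrableOn f (sectorBoundary root x) ν)
    (hfk : IntegrableOn (fun ω => poisson ν f (levelProj γ k ω)) (sectorBoundary root x) ν) :
    poisson ν (fun ω => poisson ν f (levelProj γ k ω)) x = poisson ν f x := by
  have hd : Pairwise (Function.onFun Disjoint
      fun y : {y : V // level γ y = k ∧ y ∈ sector root x} => sectorBoundary root y.1) := by
    intro y z hyz
    refine Set.disjoint_left.2 fun ω hy hz => hyz (Subtype.ext ?_)
    exact eq_of_mem_sectorBoundary hG hγ hy hz (y.2.1.trans z.2.1.symm)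
  have hm := fun y : {y : V // level γ y = k ∧ y ∈ sector root x} =>
    measurableSet_sectorBoundary (root := root) y.1
  rw [poisson_eq_setIntegral, poisson_eq_setIntegral f]
  rw [sectorBoundary_eq_iUnion hG hγ hk] at hf hfk ⊢
  rw [integral_iUnion hm hd hf, integral_iUnion hm hd hfk]
  congr 1
  refine tsum_congr fun y => ?_
  rw [setIntegral_congr_fun (hm y) (g := fun _ => poisson ν f y) fun ω hω => by
    rw [(levelProj_eq_iff hG hγ).2 ⟨y.2.1, hω⟩], setIntegral_const, poisson_eq_setIntegral,
    smul_smul]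
  have h : (flow ν y.1).toReal ≠ 0 := ENNReal.toReal_ne_zero.2 (hν _)
  rw [Measure.real]
  change ((flow ν y.1).toReal * _) • _ = _
  rw [mul_inv_cancel₀ h, one_smul]

theorem eLpNorm_poisson_le_hardyNorm [MeasurableSpace V] [DiscreteMeasurableSpace V]
    [Countable V] (hG : G.IsTree) (hγ : γ.endpoint = root)
    (hν : ∀ x : V, flow ν x ≠ 0 ∧ flow ν x ≠ ∞) {σ : Measure V} {p : ℝ≥0∞} (hp : 1 ≤ p)
    (hpt : p ≠ ∞) {C : ℝ≥0∞} (hC0 : C ≠ 0)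
    (hC : ∀ f : PuncturedBoundary G root → 𝕜, MemLp f p ν →
      eLpNorm (poisson ν f) p σ ≤ C * eLpNorm f p ν)
    {f : PuncturedBoundary G root → 𝕜} (hf : MemLp f p ν) :
    eLpNorm (poisson ν f) p σ ≤ C * hardyNorm γ ν p (poisson ν f) := by
  -- Finiteness is what puts the averaged functions `g` below in `L^p`; `C ≠ 0` is needed because `0
  -- * ∞ = 0`.
  by_cases hH : hardyNorm γ ν p (poisson ν f) = ∞
  · rw [hH, ENNReal.mul_top hC0]
    exact le_top
  have hp0 : p ≠ 0 := (zero_lt_one.trans_le hp).ne'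
  have hr : 0 < p.toReal := ENNReal.toReal_pos hp0 hpt
  let S : ℕ → Set V := fun N => {x | -(N : ℤ) ≤ level γ x}
  have hS : ⋃ N, S N = Set.univ := by
    refine Set.eq_univ_of_forall fun x => Set.mem_iUnion.2 ⟨(-level γ x).toNat, ?_⟩
    change -(((-level γ x).toNat : ℕ) : ℤ) ≤ level γ x
    omega
  have hmono : Monotone S := fun M N hMN x hx => by
    have hx : -(M : ℤ) ≤ level γ x := hx
    change -(N : ℤ) ≤ level γ x
    omega
  have key : ∀ N, eLpNorm (poisson ν f) p (σ.restrict (S N)) ≤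
      C * hardyNorm γ ν p (poisson ν f) := fun N => by
    have hle := eLpNorm_comp_levelProj_le_hardyNorm (ν := ν) hG hγ (-(N : ℤ)) hp0 hpt (poisson ν f)
    set g : PuncturedBoundary G root → 𝕜 := fun ω => poisson ν f (levelProj γ (-(N : ℤ)) ω)
    have hg : MemLp g p ν :=
      ⟨((Measurable.of_discrete (f := poisson ν f)).comp
        (measurable_levelProj hG hγ _)).aestronglyMeasurable, hle.trans_lt (lt_top_iff_ne_top.2 hH)⟩
    calc eLpNorm (poisson ν f) p (σ.restrict (S N))
        = eLpNorm (poisson ν g) p (σ.restrict (S N)) := by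
          refine eLpNorm_congr_ae ((ae_restrict_iff' .of_discrete).2 (.of_forall fun x hx => ?_))
          exact (poisson_comp_levelProj hG hγ hν hx (integrableOn_sectorBoundary hp (hν x).2 hf)
            (integrableOn_sectorBoundary hp (hν x).2 hg)).symm
      _ ≤ eLpNorm (poisson ν g) p σ := eLpNorm_mono_measure _ Measure.restrict_le_self
      _ ≤ C * eLpNorm g p ν := hC g hg
      _ ≤ _ := by gcongr
  -- After taking `p`-th powers, monotone convergence along the sets `S N` applies.
  simp only [eLpNorm_eq_lintegral_rpow_enorm_toReal hp0 hpt, one_div,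
    ENNReal.rpow_inv_le_iff hr] at key ⊢
  rw [← setLIntegral_univ, ← hS, setLIntegral_iUnion_of_directed _ hmono.directed_le]
  exact iSup_le key

end Hardy

/-! ### Testing on indicators of sector boundaries -/

section Indicator

variable {γ : Ray G} {ν : Measure (PuncturedBoundary G root)} (𝕜 : Type*) [RCLike 𝕜]

theorem poisson_indicator (x y : V) :
    poisson ν ((sectorBoundary root x).indicator fun _ => (1 : 𝕜)) y =
      (flow ν y).toReal⁻¹ • ((ν (sectorBoundary root x ∩ sectorBoundary root y)).toReal : 𝕜) := by
  rw [poisson_eq_setIntegral, integral_indicator (measurableSet_sectorBoundary x),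
    Measure.restrict_restrict (measurableSet_sectorBoundary x), setIntegral_const, Measure.real,
    RCLike.real_smul_eq_coe_mul _ (1 : 𝕜), mul_one]

/-- Since `|𝒫 f| ≤ 1`, the square is at most `|𝒫 f|`, and `|𝒫 f(y)| m_ν(y)` is at most the integral
of `f` over `∂T_y`. These sets are disjoint within one level. -/
theorem hardyNorm_poisson_indicator_le [Countable V] (hG : G.IsTree)
    (hγ : γ.endpoint = root) (hν : ∀ x : V, flow ν x ≠ 0 ∧ flow ν x ≠ ∞) (x : V) :
    hardyNorm γ ν 2 (poisson ν ((sectorBoundary root x).indicator fun _ => (1 : 𝕜))) ≤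
      flow ν x ^ (1 / 2 : ℝ) := by
  set f : PuncturedBoundary G root → 𝕜 := (sectorBoundary root x).indicator fun _ => 1
  rw [hardyNorm, if_neg (by simp), ENNReal.toReal_ofNat]
  gcongr
  refine iSup_le fun k => ?_
  have hle : ∀ y, ‖poisson ν f y‖ₑ ≤ 1 := fun y => by
    refine (enorm_poisson_le_eLpNorm_top (hν y).1 (hν y).2 f).trans ?_
    rw [eLpNorm_exponent_top]
    refine eLpNormEssSup_le_of_ae_enorm_bound (.of_forall fun ω => ?_)
    by_cases h : ω ∈ sectorBoundary root x <;> simp [f, h]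
  have hd : Pairwise (Function.onFun Disjoint
      fun y : {y : V // level γ y = k} => sectorBoundary root y.1) := by
    intro y z hyz
    refine Set.disjoint_left.2 fun ω hy hz => hyz (Subtype.ext ?_)
    exact eq_of_mem_sectorBoundary hG hγ hy hz (y.2.trans z.2.symm)
  calc ∑' y : {y : V // level γ y = k}, ‖poisson ν f y‖ₑ ^ (2 : ℝ) * flow ν y
      ≤ ∑' y : {y : V // level γ y = k}, ∫⁻ ω in sectorBoundary root y.1, ‖f ω‖ₑ ∂ν := by
        gcongr with y
        refine le_trans ?_ (enorm_poisson_mul_flow_le (hν y).1 (hν y).2 f)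
        gcongr
        rw [ENNReal.rpow_two, sq]
        exact mul_le_of_le_one_left' (hle y)
    _ ≤ ∫⁻ ω, ‖f ω‖ₑ ∂ν := by
        rw [← lintegral_iUnion (fun y : {y : V // level γ y = k} =>
          measurableSet_sectorBoundary y.1) hd]
        exact lintegral_mono' Measure.restrict_le_self le_rfl
    _ = flow ν x := by
        simp only [f, enorm_indicator_eq_indicator_enorm]
        rw [lintegral_indicator (measurableSet_sectorBoundary x)]
        simp [flow]

/-- For `y` in `T_x` the boundary `∂T_y` lies in `∂T_x`, so the average of the indicator over it is
1. -/
theorem measure_sector_le [MeasurableSpace V] [DiscreteMeasurableSpace V] {σ : Measure V}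
    (hG : G.IsTree)
    (hν : ∀ x : V, flow ν x ≠ 0 ∧ flow ν x ≠ ∞) (x : V) :
    σ (sector root x) ^ (1 / 2 : ℝ) ≤
      eLpNorm (poisson ν ((sectorBoundary root x).indicator fun _ => (1 : 𝕜))) 2 σ := by
  rw [eLpNorm_eq_lintegral_rpow_enorm_toReal (by simp) (by simp), ENNReal.toReal_ofNat]
  gcongr
  rw [← setLIntegral_one]
  refine le_trans (setLIntegral_mono' .of_discrete fun y hy => ?_)
    (lintegral_mono' Measure.restrict_le_self le_rfl)
  rw [poisson_indicator, Set.inter_eq_self_of_subset_right (sectorBoundary_subset hG hy)]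
  have h : (flow ν y).toReal ≠ 0 := ENNReal.toReal_ne_zero.2 (hν _)
  change _ ≤ ‖(flow ν y).toReal⁻¹ • ((flow ν y).toReal : 𝕜)‖ₑ ^ _
  rw [RCLike.real_smul_eq_coe_mul, ← RCLike.ofReal_mul, inv_mul_cancel₀ h]
  simp

end Indicator

end TreeCarleson

/-! ### The equivalence -/

theorem mainTheorem1 {V : Type*} [MeasurableSpace V] [DiscreteMeasurableSpace V]
    (𝕜 : Type*) [RCLike 𝕜]
    (G : SimpleGraph V) [G.LocallyFinite] (hG : G.IsTree)
    (root : TreeCarleson.Boundary G)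
    (γ : TreeCarleson.Ray G) (hγ : γ.endpoint = root)
    (ν : Measure (TreeCarleson.PuncturedBoundary G root))
    (hν : ∀ x : V, 0 < ν (TreeCarleson.sectorBoundary root x) ∧
      ν (TreeCarleson.sectorBoundary root x) < ∞)
    (σ : Measure V) :
    List.TFAE [
      TreeCarleson.IsCarleson ν σ,
      (∀ p : ℝ≥0∞, 1 < p → ∃ C : ℝ≥0, 0 < C ∧
        ∀ f : TreeCarleson.PuncturedBoundary G root → 𝕜, MemLp f p ν →
          eLpNorm (TreeCarleson.poisson ν f) p σ ≤ C * eLpNorm f p ν) ∧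
      (∃ C : ℝ≥0, 0 < C ∧
        ∀ f : TreeCarleson.PuncturedBoundary G root → 𝕜, MemLp f 1 ν →
          TreeCarleson.weakL1Norm σ (TreeCarleson.poisson ν f) ≤ C * eLpNorm f 1 ν),
      ∀ p : ℝ≥0∞, 1 < p → ∃ C : ℝ≥0, 0 < C ∧
        ∀ f : TreeCarleson.PuncturedBoundary G root → 𝕜, MemLp f p ν →
          eLpNorm (TreeCarleson.poisson ν f) p σ ≤
            C * TreeCarleson.hardyNorm γ ν p (TreeCarleson.poisson ν f)] := by
  have : Countable V := TreeCarleson.countable_of_isTree hG γ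
  have hν' : ∀ x : V, TreeCarleson.flow ν x ≠ 0 ∧ TreeCarleson.flow ν x ≠ ∞ := fun x =>
    ⟨(hν x).1.ne', (hν x).2.ne⟩
  tfae_have 1 → 2 := by
    rintro ⟨C, hC0, hC⟩
    refine ⟨fun p hp => ?_, C, hC0, fun f _ => TreeCarleson.weakL1Norm_poisson_le hG hγ hν' hC f⟩
    by_cases hpt : p = ∞
    · subst hpt
      refine ⟨1, one_pos, fun f _ => ?_⟩
      rw [ENNReal.coe_one, one_mul, eLpNorm_exponent_top]
      exact eLpNormEssSup_le_of_ae_enorm_bound (.of_forall fun x =>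
        TreeCarleson.enorm_poisson_le_eLpNorm_top (hν' x).1 (hν' x).2 f)
    have hp1 : 1 < p.toReal := by
      simpa using (ENNReal.toReal_lt_toReal ENNReal.one_ne_top hpt).2 hp
    have hp0 : p ≠ 0 := (zero_lt_one.trans hp).ne'
    set K : ℝ≥0∞ := ENNReal.ofReal p.toReal * (2 * C) / ENNReal.ofReal (p.toReal - 1) *
      ENNReal.ofReal (2 ^ (p.toReal - 1))
    have hK : K ≠ ∞ := by
      refine ENNReal.mul_ne_top (ENNReal.div_ne_top (ENNReal.mul_ne_top ENNReal.ofReal_ne_top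
        (ENNReal.mul_ne_top (by simp) ENNReal.coe_ne_top)) ?_) ENNReal.ofReal_ne_top
      simpa using hp1
    have hK' : K ^ (1 / p.toReal) ≠ ∞ := ENNReal.rpow_ne_top_of_nonneg (by positivity) hK
    -- Adding 1 makes positivity of the constant immediate.
    refine ⟨(K ^ (1 / p.toReal)).toNNReal + 1, by positivity, fun f hf => ?_⟩
    rw [ENNReal.coe_add, ENNReal.coe_toNNReal hK', eLpNorm_eq_lintegral_rpow_enorm_toReal hp0 hpt,
      eLpNorm_eq_lintegral_rpow_enorm_toReal hp0 hpt]
    calc _ ≤ (K * ∫⁻ ω, ‖f ω‖ₑ ^ p.toReal ∂ν) ^ (1 / p.toReal) := by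
          gcongr
          exact TreeCarleson.lintegral_enorm_poisson_rpow_le hG hγ hν' ENNReal.coe_ne_top hC hp1
            hf.aestronglyMeasurable
      _ ≤ _ := by
          rw [ENNReal.mul_rpow_of_nonneg _ _ (by positivity)]
          gcongr
          exact le_self_add
  tfae_have 2 → 3 := by
    rintro ⟨h, -⟩ p hp
    by_cases hpt : p = ∞
    · subst hpt
      refine ⟨1, one_pos, fun f _ => ?_⟩
      rw [ENNReal.coe_one, one_mul, eLpNorm_exponent_top, TreeCarleson.hardyNorm, if_pos rfl]
      exact eLpNormEssSup_le_of_ae_enorm_bound (.of_forall fun x =>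
        le_iSup (fun x => ‖TreeCarleson.poisson ν f x‖ₑ) x)
    obtain ⟨C, hC0, hC⟩ := h p hp
    exact ⟨C, hC0, fun f hf => TreeCarleson.eLpNorm_poisson_le_hardyNorm hG hγ hν' hp.le hpt
      (by simpa using hC0.ne') hC hf⟩
  tfae_have 3 → 1 := by
    intro h
    obtain ⟨C, hC0, hC⟩ := h 2 (by norm_num)
    -- Squaring `σ(T_x) ^ (1/2) ≤ C * ν(∂T_x) ^ (1/2)` gives this constant.
    refine ⟨C ^ 2, by positivity, fun x => ?_⟩
    have h1 := (TreeCarleson.measure_sector_le 𝕜 (σ := σ) hG hν' x).trans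
      ((hC _ (memLp_indicator_const 2 (TreeCarleson.measurableSet_sectorBoundary x) 1
        (.inr (hν' x).2))).trans
        (mul_le_mul_right (TreeCarleson.hardyNorm_poisson_indicator_le 𝕜 hG hγ hν' x) _))
    rw [one_div, ENNReal.rpow_inv_le_iff two_pos, ENNReal.mul_rpow_of_nonneg _ _ two_pos.le,
      ← ENNReal.rpow_mul, inv_mul_cancel₀ two_ne_zero, ENNReal.rpow_one, ENNReal.rpow_two] at h1
    simpa [TreeCarleson.flow] using h1
  tfae_finish
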